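/- Let $D\subseteq\mathbb{R}^d$ be open, let $f:D\to\mathbb{R}^d$ be a real-analytic vector field, and let $\varphi_h$ be the local flow of $x'=f(x)$. Let $\mathcal{S}_h^{[2]}$ be a time-symmetric integrator of order $2$ for this equation, real-analytic in $(h,x)$ near $\{0\}\times D$: $\mathcal{S}_h^{[2]}(x)=\varphi_h(x)+\mathcal{O}(h^3)$ and $\mathcal{S}_h^{[2]}\circ\mathcal{S}_{-h}^{[2]}=\mathrm{id}$ for small $h$. Use the same symbol for its holomorphic extension to complex $h$ and $x$. (Here and below, relations between maps are meant for all sufficiently small $|h|$ and locally in $x\in D$, and the constants in $\mathcal{O}(\cdot)$ are locally uniform in $x\in D$.) Let $n\ge 2$ and let $\alpha_1,\dots,\alpha_s\in\mathbb{C}$ satisfy $\alpha_{s+1-j}=\alpha_j$ for all $j$ and $\alpha_1+\cdots+\alpha_s=1$. Suppose that the left-right palindromic composition $$\mathcal{S}_h^{[2n]}=\mathcal{S}_{\alpha_s h}^{[2]}\circ\cdots\circ\mathcal{S}_{\alpha_1 h}^{[2]}$$ has order $2n$, i.e. $\mathcal{S}_h^{[2n]}(x)=\varphi_h(x)+\mathcal{O}(h^{2n+1})$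 for real $h$ and $x$. Let $$\phi_h(x)=\tfrac12\bigl(\mathcal{S}_h^{[2n]}(x)+\overline{\mathcal{S}_h^{[2n]}(x)}\bigr)=\Re\,\mathcal{S}_h^{[2n]}(x),\qquad x\in D,\ h\in\mathbb{R}.$$ Then: 1. $\phi_h$ has order $2n$: $\phi_h(x)=\varphi_h(x)+\mathcal{O}(h^{2n+1})$. 2. $\phi_h$ is a smooth and consistent integrator that is pseudo-symmetric of order $4n+1$: the adjoint $\phi_h^*:=(\phi_{-h})^{-1}$ exists locally and $\phi_h^*=\phi_h+\mathcal{O}(h^{4n+2})$. 3. If moreover $d=2m$, $f=J\nabla H$ is Hamiltonian on $D$, with $J$ the canonical symplectic matrix, and $\mathcal{S}_h^{[2]}$ is symplectic, i.e. $\bigl((\mathcal{S}_h^{[2]})'\bigr)^T J\,(\mathcal{S}_h^{[2]})'=J$ for small real $h$, then $\phi_h$ is pseudo-symplectic of order $4n+1$: $(\phi_h')^T J\,\phi_h'=J+\mathcal{O}(h^{4n+2})$. -/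

import Mathlib

open Filter Topology Asymptotics
open scoped ContDiff

namespace PalindromicComposition

/-- The coordinatewise inclusion of `ℝ^d` in `ℂ^d`. -/
def toComplex {d : ℕ} (x : Fin d → ℝ) : Fin d → ℂ := fun i => (x i : ℂ)

/-- `φ` is the exact (local) flow on `D` of the differential equation `x' = f(x)`: for `y` near a
point of `D` and `|t|` small, `t ↦ φ t y` is the solution with initial value `y`. -/
structure IsExactFlow {d : ℕ} (f : (Fin d → ℝ) → (Fin d → ℝ)) (D : Set (Fin d → ℝ))
    (φ : ℝ → (Fin d → ℝ) → (Fin d → ℝ)) : Prop where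
  initial : ∀ x ∈ D, φ 0 x = x
  solution : ∀ x ∈ D, ∀ᶠ p : ℝ × (Fin d → ℝ) in 𝓝 (0, x),
    HasDerivAt (fun t => φ t p.2) (f (φ p.1 p.2)) p.1

/-- The one-step map `ψ_h`, for real `h` and real starting points, is of order (at least) `r`:
`ψ_h(x) = exact_h(x) + O(h^(r+1))` as `h → 0`, locally uniformly for `x` in `D`. The values lie in
a normed space `V`, which is `ℝ^d` or (for complex coefficients) `ℂ^d`. -/
def HasOrder {d : ℕ} {V : Type*} [NormedAddCommGroup V] (D : Set (Fin d → ℝ))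
    (exact ψ : ℝ → (Fin d → ℝ) → V) (r : ℕ) : Prop :=
  ∀ x ∈ D, (fun p : ℝ × (Fin d → ℝ) => ψ p.1 p.2 - exact p.1 p.2) =O[𝓝 (0, x)]
    fun p => p.1 ^ (r + 1)

/-- A smooth and consistent integrator for the equation with exact flow `φ` on `D`. -/
structure IsIntegrator {d : ℕ} (D : Set (Fin d → ℝ))
    (φ ψ : ℝ → (Fin d → ℝ) → (Fin d → ℝ)) : Prop where
  smooth : ∀ x ∈ D, ∀ᶠ p in 𝓝 ((0 : ℝ), x), ContDiffAt ℝ ∞ (Function.uncurry ψ) p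
  consistent : HasOrder D φ ψ 1

/-- `ψ_h ∘ ψ_{-h} = id` for small `h`, locally on `D`. -/
def IsTimeSymmetric {d : ℕ} (D : Set (Fin d → ℝ))
    (ψ : ℝ → (Fin d → ℝ) → (Fin d → ℝ)) : Prop :=
  ∀ x ∈ D, ∀ᶠ p : ℝ × (Fin d → ℝ) in 𝓝 (0, x), ψ p.1 (ψ (-p.1) p.2) = p.2

/-- Near `x`, and for small `h`, the map `χ_h` is the adjoint `ψ_h^* = (ψ_{-h})⁻¹`: it is the
local inverse of `ψ_{-h}` with values near `x`. -/
structure IsAdjointNear {d : ℕ} (x : Fin d → ℝ)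
    (ψ χ : ℝ → (Fin d → ℝ) → (Fin d → ℝ)) : Prop where
  tendsto : Tendsto (Function.uncurry χ) (𝓝 (0, x)) (𝓝 x)
  right_inv : ∀ᶠ p : ℝ × (Fin d → ℝ) in 𝓝 (0, x), ψ (-p.1) (χ p.1 p.2) = p.2
  left_inv : ∀ᶠ p : ℝ × (Fin d → ℝ) in 𝓝 (0, x), χ p.1 (ψ (-p.1) p.2) = p.2

/-- `ψ` is a smooth and consistent integrator that is pseudo-symmetric of order `q`: the adjoint
`ψ_h^*` exists locally and `ψ_h^* = ψ_h + O(h^(q+1))`, locally uniformly on `D`. -/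
def IsPseudoSymmetric {d : ℕ} (D : Set (Fin d → ℝ))
    (φ ψ : ℝ → (Fin d → ℝ) → (Fin d → ℝ)) (q : ℕ) : Prop :=
  IsIntegrator D φ ψ ∧ ∀ x ∈ D, ∃ χ : ℝ → (Fin d → ℝ) → (Fin d → ℝ), IsAdjointNear x ψ χ ∧
    (fun p : ℝ × (Fin d → ℝ) => χ p.1 p.2 - ψ p.1 p.2) =O[𝓝 (0, x)] fun p => p.1 ^ (q + 1)

/-- The canonical symplectic matrix `[[0, I], [-I, 0]]` in the coordinates `(q, p)` of `ℝ^d`,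
`d = 2m`, where `e` says which coordinates are the positions `q` (`Sum.inl`) and which are the
momenta `p` (`Sum.inr`). Mathlib's `Matrix.J` is `[[0, -I], [I, 0]]`. -/
def canonicalJ {d m : ℕ} (e : Fin m ⊕ Fin m ≃ Fin d) : Matrix (Fin d) (Fin d) ℝ :=
  Matrix.reindex e e (-Matrix.J (Fin m) ℝ)

/-- The gradient of `H` at `x`. -/
noncomputable def grad {d : ℕ} (H : (Fin d → ℝ) → ℝ) (x : Fin d → ℝ) : Fin d → ℝ :=
  fun i => fderiv ℝ H x (Pi.single i 1)

/-- `f` is on `D` the Hamiltonian vector field `J ∇H` of some function `H`. -/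
def IsHamiltonian {d m : ℕ} (e : Fin m ⊕ Fin m ≃ Fin d) (D : Set (Fin d → ℝ))
    (f : (Fin d → ℝ) → (Fin d → ℝ)) : Prop :=
  ∃ H : (Fin d → ℝ) → ℝ, ∀ x ∈ D,
    DifferentiableAt ℝ H x ∧ f x = (canonicalJ e).mulVec (grad H x)

/-- The Jacobian matrix of `g` at `x`. -/
noncomputable def jacobian {d : ℕ} (g : (Fin d → ℝ) → (Fin d → ℝ)) (x : Fin d → ℝ) :
    Matrix (Fin d) (Fin d) ℝ :=
  LinearMap.toMatrix' (fderiv ℝ g x : (Fin d → ℝ) →ₗ[ℝ] (Fin d → ℝ))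

/-- `(ψ_h')ᵀ J ψ_h' = J` for small `h`, locally on `D`. -/
def IsSymplectic {d m : ℕ} (e : Fin m ⊕ Fin m ≃ Fin d) (D : Set (Fin d → ℝ))
    (ψ : ℝ → (Fin d → ℝ) → (Fin d → ℝ)) : Prop :=
  ∀ x ∈ D, ∀ᶠ p : ℝ × (Fin d → ℝ) in 𝓝 (0, x),
    (jacobian (ψ p.1) p.2).transpose * canonicalJ e * jacobian (ψ p.1) p.2 = canonicalJ e

/-- `ψ` is a smooth and consistent integrator that is pseudo-symplectic of order `k`:
`(ψ_h')ᵀ J ψ_h' = J + O(h^(k+1))` (entry by entry), locally uniformly on `D`. -/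
def IsPseudoSymplectic {d m : ℕ} (e : Fin m ⊕ Fin m ≃ Fin d) (D : Set (Fin d → ℝ))
    (φ ψ : ℝ → (Fin d → ℝ) → (Fin d → ℝ)) (k : ℕ) : Prop :=
  IsIntegrator D φ ψ ∧ ∀ x ∈ D, ∀ i j : Fin d,
    (fun p : ℝ × (Fin d → ℝ) =>
      ((jacobian (ψ p.1) p.2).transpose * canonicalJ e * jacobian (ψ p.1) p.2 - canonicalJ e) i j)
      =O[𝓝 (0, x)] fun p => p.1 ^ (k + 1)

/-- `S` extends the real one-step map `R` holomorphically to complex steps and complex points, near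
`h = 0` and the points of `D`. Such an `S` exists as soon as `R` is real-analytic there, and its
germ is unique. -/
structure IsComplexExtension {d : ℕ} (D : Set (Fin d → ℝ))
    (R : ℝ → (Fin d → ℝ) → (Fin d → ℝ)) (S : ℂ → (Fin d → ℂ) → (Fin d → ℂ)) : Prop where
  analytic : ∀ x ∈ D, AnalyticAt ℂ (Function.uncurry S) (0, toComplex x)
  extends_real : ∀ x ∈ D, ∀ᶠ p : ℝ × (Fin d → ℝ) in 𝓝 (0, x),
    S (p.1 : ℂ) (toComplex p.2) = toComplex (R p.1 p.2)

/-- For `α = [α₁, …, α_s]`, the map `S_{α_s h} ∘ ⋯ ∘ S_{α₁ h}`. -/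
def composition {d : ℕ} (S : ℂ → (Fin d → ℂ) → (Fin d → ℂ)) :
    List ℂ → ℂ → (Fin d → ℂ) → (Fin d → ℂ)
  | [], _, w => w
  | a :: l, h, w => composition S l h (S (a * h) w)

/-- The composition for real steps and real starting points; its values are complex. -/
def compositionOnReal {d : ℕ} (S : ℂ → (Fin d → ℂ) → (Fin d → ℂ)) (α : List ℂ) :
    ℝ → (Fin d → ℝ) → (Fin d → ℂ) :=
  fun h x => composition S α (h : ℂ) (toComplex x)

/-- The real part of a one-step map with complex values. -/
def realPart {d : ℕ} (ψ : ℝ → (Fin d → ℝ) → (Fin d → ℂ)) :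
    ℝ → (Fin d → ℝ) → (Fin d → ℝ) :=
  fun h x i => (ψ h x i).re

/-- The real part is `(ψ_h + ψ̄_h) / 2`. -/
theorem toComplex_realPart {d : ℕ} (ψ : ℝ → (Fin d → ℝ) → (Fin d → ℂ)) (h : ℝ)
    (x : Fin d → ℝ) :
    toComplex (realPart ψ h x) = (1 / 2 : ℂ) • (ψ h x + star (ψ h x)) := by
  funext i
  apply Complex.ext
  · simp [toComplex, realPart]; ring
  · simp [toComplex, realPart]

end PalindromicComposition

/-! Write `Ψ_h` for the complex composition and put `N = 2n + 1`. Time symmetry of the basic method,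
known at real points, extends to complex steps and points by the identity theorem. The palindromic
coefficients then give `Ψ_h ∘ Ψ_{-h} = id` (`composition_reverse_comp`). Since the exact flow is
real, the order condition makes `Im Ψ_h = O(h^N)` at real points. By analyticity its `x`-derivative
is also `O(h^N)` (`fderiv_partial_isBigO`).

Let `Ψ_h(x) = a + ib`. Taylor expansion of `x = Ψ_{-h}(a + ib)` at `a` has real part `x = Re
Ψ_{-h}(a) - (Im Ψ_{-h})'(a) b + O(b²)`. Both correction terms are products of two `O(h^N)`
quantities, so `φ_{-h} ∘ φ_h = id + O(h^{2N})` for the real part `φ` (`realPart_almost_symmetric`).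
The inverse function theorem turns this into closeness of `φ` to its adjoint (`exists_adjoint`).

For the symplectic claim, let `A + iB` be the Jacobian of `Ψ_h` at a real point. It preserves `J`,
and the real part of that identity is `AᵀJA - J = BᵀJB`, where `B = O(h^N)` is the `x`-derivative of
`Im Ψ_h` (`realPart_almost_preserves_form`). In both cases the error exponent is `2N = 4n + 2`. -/

namespace PalindromicComposition

/-! ### Orders of vanishing in the step size, and their behaviour under differentiation. -/

section Vanishing

variable {E V : Type*} [NormedAddCommGroup E] [NormedSpace ℝ E]
  [NormedAddCommGroup V] [NormedSpace ℝ V]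

/-- Differentiation lowers the order of vanishing of an analytic function by at most one. -/
theorem deriv_isBigO_pow [CompleteSpace V] {g : ℝ → V} (hg : AnalyticAt ℝ g 0) (N : ℕ)
    (h : g =O[𝓝 0] fun t => t ^ (N + 1)) : deriv g =O[𝓝 0] fun t => t ^ N := by
  by_cases htop : analyticOrderAt g 0 = ⊤
  · rw [analyticOrderAt_eq_top] at htop
    have h1 : deriv g =ᶠ[𝓝 0] deriv (fun _ => (0 : V)) := Filter.EventuallyEq.deriv htop
    refine h1.trans_isBigO ?_
    simpa using isBigO_zero _ _
  · obtain ⟨k, hk, hk0, hgk⟩ := (hg.analyticOrderAt_ne_top).1 htop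
    set m := analyticOrderNatAt g 0
    simp only [sub_zero] at hgk
    -- Here `g = t^m k(t)` with `k 0 ≠ 0`. If `m ≤ N`, dividing the bound by `t^m` away from `0`
    -- would force `k → 0`.
    have hm : N + 1 ≤ m := by
      by_contra! hlt
      obtain ⟨q, hq⟩ : ∃ q, N + 1 = m + (q + 1) := ⟨N - m, by omega⟩
      have h2 : (fun t : ℝ => t ^ m • k t) =O[𝓝[≠] 0] fun t => t ^ m * t ^ (q + 1) := by
        have := (hgk.symm.trans_isBigO h).mono (nhdsWithin_le_nhds (s := {0}ᶜ))
        simpa only [hq, pow_add, mul_assoc] using this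
      have h3 : k =O[𝓝[≠] 0] fun t : ℝ => t ^ (q + 1) := by
        obtain ⟨C, hC⟩ := h2.bound
        refine IsBigO.of_bound C ?_
        filter_upwards [hC, self_mem_nhdsWithin] with t ht ht0
        have hpos : 0 < ‖t ^ m‖ := norm_pos_iff.2 (pow_ne_zero _ ht0)
        rw [norm_smul, norm_mul] at ht
        refine le_of_mul_le_mul_left (ht.trans_eq ?_) hpos
        ring
      have h4 : Tendsto k (𝓝[≠] 0) (𝓝 0) := by
        refine h3.trans_tendsto ?_
        have : Tendsto (fun t : ℝ => t ^ (q + 1)) (𝓝 0) (𝓝 (0 ^ (q + 1))) :=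
          (continuous_pow _).tendsto 0
        simpa using this.mono_left nhdsWithin_le_nhds
      exact hk0 (tendsto_nhds_unique (hk.continuousAt.tendsto.mono_left nhdsWithin_le_nhds) h4)
    obtain ⟨q, hq⟩ : ∃ q, m = N + 1 + q := ⟨m - (N + 1), by omega⟩
    have hd : deriv g =ᶠ[𝓝 0]
        fun t => t ^ N • (t ^ (q + 1) • deriv k t + ((m : ℝ) * t ^ q) • k t) := by
      refine (Filter.EventuallyEq.deriv hgk).trans ?_
      filter_upwards [hk.eventually_analyticAt] with t ht
      have := ((hasDerivAt_pow m t).smul ht.differentiableAt.hasDerivAt).deriv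
      refine Eq.trans this ?_
      have e1 : m - 1 = N + q := by omega
      rw [e1, hq, smul_add, smul_smul, smul_smul]
      congr 2 <;> ring
    refine hd.trans_isBigO ?_
    have hc : ContinuousAt (fun t => t ^ (q + 1) • deriv k t + ((m : ℝ) * t ^ q) • k t) 0 := by
      have := hk.deriv.continuousAt
      have := hk.continuousAt
      fun_prop
    have := (isBigO_refl (fun t : ℝ => t ^ N) (𝓝 0)).smul (hc.isBigO_one ℝ)
    simpa using this

/-- The mean value inequality in the first variable. -/
theorem isBigO_pow_succ_of_partial {K : ℝ × E → V} {x₀ : E} {N : ℕ}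
    (hK : ∀ᶠ p in 𝓝 ((0 : ℝ), x₀), DifferentiableAt ℝ K p)
    (h0 : ∀ᶠ x in 𝓝 x₀, K (0, x) = 0)
    (hd : (fun p => fderiv ℝ K p (1, 0)) =O[𝓝 ((0 : ℝ), x₀)] fun p => p.1 ^ N) :
    K =O[𝓝 ((0 : ℝ), x₀)] fun p => p.1 ^ (N + 1) := by
  obtain ⟨C, hC⟩ := hd.bound
  have h0' : ∀ᶠ p : ℝ × E in 𝓝 ((0 : ℝ), x₀), K (0, p.2) = 0 :=
    (continuous_snd.tendsto ((0 : ℝ), x₀)).eventually h0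
  obtain ⟨r, hr, hball⟩ := Metric.eventually_nhds_iff_ball.1 (hK.and (hC.and h0'))
  refine IsBigO.of_bound C ?_
  filter_upwards [Metric.ball_mem_nhds _ hr] with p hp
  obtain ⟨h, x⟩ := p
  have hmem : ∀ t ∈ Metric.closedBall (0 : ℝ) |h|, (t, x) ∈ Metric.ball ((0 : ℝ), x₀) r := by
    intro t ht
    rw [Metric.mem_ball, Prod.dist_eq, max_lt_iff] at hp ⊢
    refine ⟨lt_of_le_of_lt ?_ hp.1, hp.2⟩
    simpa using ht
  -- The big-O constant need not be nonnegative, so `|C|` is used to replace `|t|` by `|h|`. When `h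
  -- ≠ 0`, the bound at `(h, x)` itself forces `0 ≤ C`.
  have hC0 : ∀ t ∈ Metric.closedBall (0 : ℝ) |h|,
      ‖fderiv ℝ K (t, x) (1, 0)‖ ≤ |C| * |h| ^ N := by
    intro t ht
    refine (hball _ (hmem t ht)).2.1.trans ?_
    have : |t| ≤ |h| := by simpa using ht
    rw [norm_pow, Real.norm_eq_abs]
    gcongr
    exact le_abs_self C
  have key := (convex_closedBall (0 : ℝ) |h|).norm_image_sub_le_of_norm_hasDerivWithin_le
    (f := fun t => K (t, x)) (f' := fun t => fderiv ℝ K (t, x) (1, 0))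
    (C := |C| * |h| ^ N) (x := 0) (y := h) ?_ hC0 (by simp) (by simp)
  · have hz : K (0, x) = 0 := (hball _ hp).2.2
    have hCC : ‖fderiv ℝ K (h, x) (1, 0)‖ ≤ C * ‖h ^ N‖ := (hball _ hp).2.1
    rw [hz, sub_zero, sub_zero] at key
    rcases eq_or_ne h 0 with rfl | hh
    · simp [hz]
    · have hCnn : 0 ≤ C := by
        have : 0 ≤ C * ‖h ^ N‖ := (norm_nonneg _).trans hCC
        exact nonneg_of_mul_nonneg_left this (norm_pos_iff.2 (pow_ne_zero _ hh))
      rw [abs_of_nonneg hCnn] at key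
      refine key.trans_eq ?_
      simp only [norm_pow, Real.norm_eq_abs]
      ring
  · intro t ht
    have h1 := (hball _ (hmem t ht)).1.hasFDerivAt
    have h2 : HasDerivAt (fun s : ℝ => (s, x)) ((1 : ℝ), (0 : E)) t :=
      (hasDerivAt_id t).prodMk (hasDerivAt_const t x)
    exact (h1.comp_hasDerivAt t h2).hasDerivWithinAt

/-- Induction on `N`, passing from `G` to `∂_h G`. The induction hypothesis bounds `∂_x ∂_h G = ∂_h
∂_x G` by `O(h^N)`, and integrating in `h` from `∂_x G (0, x) = 0` gains one power. The hypothesis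
is only pointwise in `x` because `deriv_isBigO_pow` gives constants that may depend on `x`; the
integration restores uniformity. -/
theorem fderiv_partial_isBigO_of_pointwise [CompleteSpace V] (N : ℕ) :
    ∀ {G : ℝ × E → V} {x₀ : E}, AnalyticAt ℝ G (0, x₀) →
      (∀ᶠ x in 𝓝 x₀, (fun t => G (t, x)) =O[𝓝 0] fun t => t ^ N) →
      (fun p => (fderiv ℝ G p).comp (ContinuousLinearMap.inr ℝ ℝ E))
        =O[𝓝 ((0 : ℝ), x₀)] fun p => p.1 ^ N := by
  induction N with
  | zero =>
    intro G x₀ hG _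
    have : ContinuousAt (fun p => (fderiv ℝ G p).comp (ContinuousLinearMap.inr ℝ ℝ E)) (0, x₀) :=
      hG.fderiv.continuousAt.clm_comp continuousAt_const
    simpa using this.isBigO_one ℝ
  | succ N ih =>
    intro G x₀ hG hO
    have hmk : Tendsto (fun x : E => ((0 : ℝ), x)) (𝓝 x₀) (𝓝 (0, x₀)) :=
      (Continuous.prodMk_right (0 : ℝ)).tendsto x₀
    have han : ∀ᶠ x in 𝓝 x₀, AnalyticAt ℝ G (0, x) := hmk.eventually hG.eventually_analyticAt
    have hz : ∀ᶠ x in 𝓝 x₀, G (0, x) = 0 := by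
      filter_upwards [hO] with x hx
      have := hx.bound
      obtain ⟨C, hC⟩ := this
      have := hC.self_of_nhds
      simpa using this
    have hline : ∀ (t : ℝ) (x : E), HasDerivAt (fun s : ℝ => (s, x)) ((1 : ℝ), (0 : E)) t :=
      fun t x => (hasDerivAt_id t).prodMk (hasDerivAt_const t x)
    have hG1 : AnalyticAt ℝ (fun p => fderiv ℝ G p (1, 0)) (0, x₀) :=
      ((ContinuousLinearMap.apply ℝ V ((1 : ℝ), (0 : E))).analyticAt _).comp hG.fderiv
    have hO1 : ∀ᶠ x in 𝓝 x₀, (fun t => fderiv ℝ G (t, x) (1, 0)) =O[𝓝 0] fun t => t ^ N := by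
      filter_upwards [hO, han] with x hx hax
      have hcomp : AnalyticAt ℝ (fun t : ℝ => G (t, x)) 0 :=
        hax.comp_of_eq (f := fun t : ℝ => (t, x)) (AnalyticAt.prod analyticAt_id analyticAt_const) rfl
      refine IsBigO.congr' (deriv_isBigO_pow hcomp N hx) ?_ EventuallyEq.rfl
      have hmk' : Tendsto (fun t : ℝ => (t, x)) (𝓝 0) (𝓝 (0, x)) :=
        (Continuous.prodMk_left x).tendsto 0
      filter_upwards [hmk'.eventually hax.eventually_analyticAt] with t ht
      exact (ht.differentiableAt.hasFDerivAt.comp_hasDerivAt t (hline t x)).deriv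
    have hih := ih hG1 hO1
    refine isBigO_pow_succ_of_partial ?_ ?_ ?_
    · filter_upwards [hG.eventually_analyticAt] with p hp
      exact hp.fderiv.differentiableAt.clm_comp (differentiableAt_const _)
    · filter_upwards [han, hz.eventually_nhds] with x hx hzx
      have h1 : HasFDerivAt (fun y : E => ((0 : ℝ), y)) (ContinuousLinearMap.inr ℝ ℝ E) x :=
        hasFDerivAt_prodMk_right 0 x
      have h2 := (hx.differentiableAt.hasFDerivAt.comp x h1).fderiv
      have h3 : (G ∘ fun y : E => ((0 : ℝ), y)) =ᶠ[𝓝 x] fun _ => 0 := hzx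
      rw [← h2, h3.fderiv_eq]
      simp
    · refine IsBigO.congr' hih ?_ EventuallyEq.rfl
      filter_upwards [hG.eventually_analyticAt] with p hp
      -- Symmetry of the second derivative exchanges `∂_h` and `∂_x`.
      have hs : IsSymmSndFDerivAt ℝ G p :=
        (hp.contDiffAt (n := 2)).isSymmSndFDerivAt (by simp)
      have hd := hp.fderiv.differentiableAt
      ext v
      rw [fderiv_clm_apply hd (differentiableAt_const _),
        fderiv_clm_comp hd (differentiableAt_const _)]
      simpa using hs (0, v) (1, 0)

/-- If an analytic family `G (h, ·)` is `O(h^N)`, locally uniformly, then so is its derivative in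
the second variable. -/
theorem fderiv_partial_isBigO [CompleteSpace V] {N : ℕ} {G : ℝ × E → V} {x₀ : E}
    (hG : AnalyticAt ℝ G (0, x₀)) (hO : G =O[𝓝 ((0 : ℝ), x₀)] fun p => p.1 ^ N) :
    (fun p => (fderiv ℝ G p).comp (ContinuousLinearMap.inr ℝ ℝ E))
      =O[𝓝 ((0 : ℝ), x₀)] fun p => p.1 ^ N := by
  refine fderiv_partial_isBigO_of_pointwise N hG ?_
  obtain ⟨C, hC⟩ := hO.bound
  have hmk : Tendsto (fun x : E => ((0 : ℝ), x)) (𝓝 x₀) (𝓝 (0, x₀)) :=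
    (Continuous.prodMk_right (0 : ℝ)).tendsto x₀
  filter_upwards [hmk.eventually hC.eventually_nhds] with x hx
  exact IsBigO.of_bound C (((Continuous.prodMk_left x).tendsto (0 : ℝ)).eventually hx)

end Vanishing

/-! ### A locally uniform quadratic Taylor remainder. -/

section Taylor

variable {E V : Type*} [NormedAddCommGroup E] [NormedSpace ℂ E]
  [NormedAddCommGroup V] [NormedSpace ℂ V]

/-- Second-order Taylor estimate, uniform near a point. -/
theorem taylor_two_bound [CompleteSpace V] {F : E → V} {w₀ : E} (hF : AnalyticAt ℂ F w₀) :
    ∃ C : ℝ, ∀ᶠ p : E × E in 𝓝 (w₀, w₀),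
      ‖F p.1 - F p.2 - fderiv ℂ F p.2 (p.1 - p.2)‖ ≤ C * ‖p.1 - p.2‖ ^ 2 := by
  -- The derivative of `F` is itself `C¹`, hence Lipschitz near `w₀`; its Lipschitz constant serves
  -- as the remainder constant.
  obtain ⟨K, s, hs, hLip⟩ :=
    ((hF.fderiv.contDiffAt (n := 1)).hasStrictFDerivAt (by simp)).exists_lipschitzOnWith
  obtain ⟨r, hr, hball⟩ := Metric.eventually_nhds_iff_ball.1
    (hF.eventually_analyticAt.and (eventually_mem_set.2 hs))
  refine ⟨K, ?_⟩
  filter_upwards [prod_mem_nhds (Metric.ball_mem_nhds w₀ hr) (Metric.ball_mem_nhds w₀ hr)]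
    with p hp
  obtain ⟨y, x⟩ := p
  have hseg : segment ℝ x y ⊆ Metric.ball w₀ r := (convex_ball w₀ r).segment_subset hp.2 hp.1
  have key := (convex_segment x y).norm_image_sub_le_of_norm_hasFDerivWithin_le'
    (𝕜 := ℂ) (f := F) (f' := fderiv ℂ F) (φ := fderiv ℂ F x) (C := K * ‖y - x‖)
    (fun z hz => (hball z (hseg hz)).1.differentiableAt.hasFDerivAt.hasFDerivWithinAt)
    (fun z hz => ?_) (left_mem_segment ℝ x y) (right_mem_segment ℝ x y)
  · refine key.trans_eq ?_
    ring
  · refine (hLip.norm_sub_le (hball z (hseg hz)).2 (hball x hp.2).2).trans ?_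
    have := norm_sub_le_of_mem_segment hz
    gcongr

end Taylor

/-! ### Real and imaginary parts of vectors, and the identity theorem from real points. -/

section ComplexCoordinates

variable {d : ℕ}

/-- The inclusion of `ℝ^d` in `ℂ^d` as a continuous linear map. -/
noncomputable def toComplexL : (Fin d → ℝ) →L[ℝ] (Fin d → ℂ) :=
  ContinuousLinearMap.pi fun i => Complex.ofRealCLM.comp (ContinuousLinearMap.proj i)

/-- The coordinatewise real part. -/
noncomputable def reL : (Fin d → ℂ) →L[ℝ] (Fin d → ℝ) :=
  ContinuousLinearMap.pi fun i => Complex.reCLM.comp (ContinuousLinearMap.proj i)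

@[simp] theorem reL_apply (w : Fin d → ℂ) (i : Fin d) : reL w i = (w i).re := rfl

/-- The coordinatewise imaginary part. -/
noncomputable def imL : (Fin d → ℂ) →L[ℝ] (Fin d → ℝ) :=
  ContinuousLinearMap.pi fun i => Complex.imCLM.comp (ContinuousLinearMap.proj i)

@[simp] theorem imL_apply (w : Fin d → ℂ) (i : Fin d) : imL w i = (w i).im := rfl

@[simp] theorem reL_toComplex (x : Fin d → ℝ) : reL (toComplex x) = x := by
  ext i; simp [toComplex]

@[simp] theorem imL_toComplex (x : Fin d → ℝ) : imL (toComplex x) = 0 := by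
  ext i; simp [toComplex]

theorem toComplex_reL_add (w : Fin d → ℂ) :
    toComplex (reL w) + Complex.I • toComplex (imL w) = w := by
  ext i
  simp only [toComplex, Pi.add_apply, Pi.smul_apply, reL_apply, imL_apply, smul_eq_mul]
  rw [mul_comm]
  exact Complex.re_add_im _

theorem norm_toComplex (x : Fin d → ℝ) : ‖toComplex x‖ = ‖x‖ := by
  simp [Pi.norm_def, toComplex]

theorem norm_reL_le (w : Fin d → ℂ) : ‖reL w‖ ≤ ‖w‖ :=
  (pi_norm_le_iff_of_nonneg (norm_nonneg _)).2 fun i =>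
    (Complex.abs_re_le_norm _).trans (norm_le_pi_norm w i)

theorem norm_imL_le (w : Fin d → ℂ) : ‖imL w‖ ≤ ‖w‖ :=
  (pi_norm_le_iff_of_nonneg (norm_nonneg _)).2 fun i =>
    (Complex.abs_im_le_norm _).trans (norm_le_pi_norm w i)

/-- The inclusion of `ℝ × ℝ^d` in `ℂ × ℂ^d`. -/
noncomputable def realPoint : ℝ × (Fin d → ℝ) →L[ℝ] ℂ × (Fin d → ℂ) :=
  Complex.ofRealCLM.prodMap toComplexL

@[simp] theorem realPoint_apply (p : ℝ × (Fin d → ℝ)) :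
    realPoint p = ((p.1 : ℂ), toComplex p.2) := rfl

theorem norm_realPoint (p : ℝ × (Fin d → ℝ)) : ‖realPoint p‖ = ‖p‖ := by
  simp [Prod.norm_def, norm_toComplex]

/-- An analytic function near a real point that vanishes at the real points vanishes. -/
theorem eventually_eq_zero_of_real {V : Type*} [NormedAddCommGroup V] [NormedSpace ℂ V]
    [CompleteSpace V] {F : ℂ × (Fin d → ℂ) → V} {p₀ : ℝ × (Fin d → ℝ)}
    (hF : AnalyticAt ℂ F (realPoint p₀)) (h0 : ∀ᶠ p in 𝓝 p₀, F (realPoint p) = 0) :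
    ∀ᶠ z in 𝓝 (realPoint p₀), F z = 0 := by
  obtain ⟨r, hr, hball⟩ := Metric.eventually_nhds_iff_ball.1 hF.eventually_analyticAt
  obtain ⟨r', hr', hball'⟩ := Metric.eventually_nhds_iff_ball.1 h0
  set ρ := min r r' with hρ
  have hρ0 : 0 < ρ := lt_min hr hr'
  -- With `z - p₀ = a + ib`, the factor 3 covers `‖a‖ + 2‖b‖ ≤ 3‖u‖` on the disc `|t| < 2` used
  -- below.
  filter_upwards [Metric.ball_mem_nhds (realPoint p₀) (ε := ρ / 3) (by positivity)] with z hz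
  set u := z - realPoint p₀ with hu
  have huz : ‖u‖ < ρ / 3 := by simpa [hu, dist_eq_norm] using hz
  set a : ℝ × (Fin d → ℝ) := (u.1.re, reL u.2) with ha
  set b : ℝ × (Fin d → ℝ) := (u.1.im, imL u.2) with hb
  have hab : realPoint a + Complex.I • realPoint b = u := by
    refine Prod.ext ?_ (toComplex_reL_add u.2)
    simp only [ha, hb, realPoint_apply, Prod.fst_add, Prod.smul_fst, smul_eq_mul]
    rw [mul_comm]
    exact Complex.re_add_im _
  have hna : ‖a‖ ≤ ‖u‖ := max_le_max (Complex.abs_re_le_norm u.1) (norm_reL_le _)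
  have hnb : ‖b‖ ≤ ‖u‖ := max_le_max (Complex.abs_im_le_norm u.1) (norm_imL_le _)
  -- This complex line meets real points for real `t` and passes through `z` at `t = i`, so the
  -- one-variable identity theorem suffices.
  set g : ℂ → ℂ × (Fin d → ℂ) := fun t => realPoint p₀ + realPoint a + t • realPoint b with hg
  have hgan : ∀ t, AnalyticAt ℂ g t := fun t =>
    analyticAt_const.add (analyticAt_id.smul analyticAt_const)
  have hgball : ∀ t ∈ Metric.ball (0 : ℂ) 2, g t ∈ Metric.ball (realPoint p₀) r := by
    intro t ht
    have ht2 : ‖t‖ < 2 := by simpa using ht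
    have e : g t - realPoint p₀ = realPoint a + t • realPoint b := by simp only [hg]; abel
    rw [Metric.mem_ball, dist_eq_norm, e]
    calc ‖realPoint a + t • realPoint b‖ ≤ ‖realPoint a‖ + ‖t • realPoint b‖ := norm_add_le _ _
      _ = ‖a‖ + ‖t‖ * ‖b‖ := by rw [norm_smul, norm_realPoint, norm_realPoint]
      _ ≤ ‖u‖ + 2 * ‖u‖ := by gcongr
      _ < ρ := by linarith
      _ ≤ r := min_le_left _ _
  have hgreal : ∀ t : ℝ, g t = realPoint (p₀ + a + t • b) := by
    intro t
    simp only [hg, map_add, map_smul]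
    congr 1
  have hFg : AnalyticOnNhd ℂ (fun t => F (g t)) (Metric.ball 0 2) := fun t ht =>
    (hball _ (hgball t ht)).comp (hgan t)
  have hfreq : ∃ᶠ t in 𝓝[≠] (0 : ℂ), F (g t) = 0 := by
    have htend : Tendsto (fun t : ℝ => (t : ℂ)) (𝓝[≠] 0) (𝓝[≠] 0) := by
      refine tendsto_nhdsWithin_of_tendsto_nhds_of_eventually_within _ ?_ ?_
      · exact (Complex.continuous_ofReal.tendsto' 0 0 (by simp)).mono_left nhdsWithin_le_nhds
      · filter_upwards [self_mem_nhdsWithin] with t ht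
        simpa using ht
    refine htend.frequently (Eventually.frequently ?_)
    refine nhdsWithin_le_nhds ?_
    filter_upwards [Metric.ball_mem_nhds (0 : ℝ) one_pos] with t ht
    have ht1 : |t| < 1 := by simpa using ht
    rw [hgreal]
    refine hball' _ ?_
    have e : p₀ + a + t • b - p₀ = a + t • b := by abel
    rw [Metric.mem_ball, dist_eq_norm, e]
    calc ‖a + t • b‖ ≤ ‖a‖ + ‖t • b‖ := norm_add_le _ _
      _ = ‖a‖ + |t| * ‖b‖ := by rw [norm_smul, Real.norm_eq_abs]
      _ ≤ ‖u‖ + 1 * ‖u‖ := by gcongr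
      _ < ρ := by linarith
      _ ≤ r' := min_le_right _ _
  have hI : Complex.I ∈ Metric.ball (0 : ℂ) 2 := by simp
  have := hFg.eqOn_zero_of_preconnected_of_frequently_eq_zero
    (convex_ball (0 : ℂ) 2).isPreconnected (by simp) hfreq hI
  have e : g Complex.I = z := by
    simp only [hg]
    rw [add_assoc, hab, hu]
    abel
  simpa [e] using this

end ComplexCoordinates

/-! ### The adjoint from the inverse function theorem. -/

section Adjoint

variable {d : ℕ}

/-- The inverse function theorem gives the adjoint of a one-step map; if the map is almost
time-symmetric, the adjoint is close to it. -/
theorem exists_adjoint {Φ : ℝ → (Fin d → ℝ) → (Fin d → ℝ)} {x₀ : Fin d → ℝ} {M : ℕ}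
    (hΦ : AnalyticAt ℝ (Function.uncurry Φ) (0, x₀)) (h0 : ∀ᶠ y in 𝓝 x₀, Φ 0 y = y)
    (hsymm : (fun p : ℝ × (Fin d → ℝ) => Φ (-p.1) (Φ p.1 p.2) - p.2)
      =O[𝓝 ((0 : ℝ), x₀)] fun p => p.1 ^ M) :
    ∃ χ : ℝ → (Fin d → ℝ) → (Fin d → ℝ), IsAdjointNear x₀ Φ χ ∧
      (fun p : ℝ × (Fin d → ℝ) => χ p.1 p.2 - Φ p.1 p.2) =O[𝓝 ((0 : ℝ), x₀)] fun p => p.1 ^ M := by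
  have hx₀ : Φ 0 x₀ = x₀ := h0.self_of_nhds
  set A := fderiv ℝ (Function.uncurry Φ) (0, x₀) with hA
  have hA2 : ∀ v, A (0, v) = v := by
    intro v
    have h1 : HasFDerivAt (fun y : Fin d → ℝ => ((0 : ℝ), y)) (ContinuousLinearMap.inr ℝ ℝ _) x₀ :=
      hasFDerivAt_prodMk_right 0 x₀
    have h2 := hΦ.differentiableAt.hasFDerivAt.comp x₀ h1
    have h3 : (Function.uncurry Φ ∘ fun y : Fin d → ℝ => ((0 : ℝ), y)) =ᶠ[𝓝 x₀] id := h0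
    have h4 := (h2.congr_of_eventuallyEq h3.symm).unique (hasFDerivAt_id x₀)
    simpa using congrArg (fun l => l v) h4
  have hA' : ∀ (a : ℝ) v, A (a, v) = A (a, 0) + v := by
    intro a v
    rw [← hA2 v, ← map_add, hA2]
    simp
  let B : (Fin d → ℝ) := A (1, 0)
  have hB : ∀ a : ℝ, A (a, 0) = a • B := by
    intro a
    rw [← map_smul]
    simp
  -- `fwd` is the derivative at `(0, x₀)` of `T (h, y) = (h, Φ_{-h}(y))`. Since `Φ_0 = id`, `A (a,
  -- v) = a B + v`, so `fwd` is the shear `(a, v - a B)`, with inverse `bwd`.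
  let fwd : ℝ × (Fin d → ℝ) →L[ℝ] ℝ × (Fin d → ℝ) :=
    (ContinuousLinearMap.fst ℝ ℝ _).prod
      (A.comp ((-ContinuousLinearMap.fst ℝ ℝ (Fin d → ℝ)).prod
        (ContinuousLinearMap.snd ℝ ℝ (Fin d → ℝ))))
  let bwd : ℝ × (Fin d → ℝ) →L[ℝ] ℝ × (Fin d → ℝ) :=
    (ContinuousLinearMap.fst ℝ ℝ _).prod A
  let L : (ℝ × (Fin d → ℝ)) ≃L[ℝ] (ℝ × (Fin d → ℝ)) :=
    ContinuousLinearEquiv.equivOfInverse fwd bwd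
      (by
        rintro ⟨a, v⟩
        refine Prod.ext rfl ?_
        change A (a, A (-a, v)) = v
        rw [hA', hA' (-a), hB, hB]
        module)
      (by
        rintro ⟨a, v⟩
        refine Prod.ext rfl ?_
        change A (-a, A (a, v)) = v
        rw [hA', hA' a, hB, hB]
        module)
  let T : ℝ × (Fin d → ℝ) → ℝ × (Fin d → ℝ) := fun p => (p.1, Φ (-p.1) p.2)
  have hT0 : T (0, x₀) = (0, x₀) := by simp [T, hx₀]
  have hneg : HasStrictFDerivAt (fun p : ℝ × (Fin d → ℝ) => (-p.1, p.2))
      ((-ContinuousLinearMap.fst ℝ ℝ (Fin d → ℝ)).prod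
        (ContinuousLinearMap.snd ℝ ℝ (Fin d → ℝ))) (0, x₀) :=
    hasStrictFDerivAt_fst.neg.prodMk hasStrictFDerivAt_snd
  have hΦs : HasStrictFDerivAt (Function.uncurry Φ) A (-(0 : ℝ), x₀) := by
    simpa using hΦ.hasStrictFDerivAt
  have hT : HasStrictFDerivAt T (L : (ℝ × (Fin d → ℝ)) →L[ℝ] (ℝ × (Fin d → ℝ))) (0, x₀) :=
    hasStrictFDerivAt_fst.prodMk (hΦs.comp ((0 : ℝ), x₀) hneg)
  set P := hT.localInverse T L (0, x₀) with hP
  have hPd : HasStrictFDerivAt P (L.symm : (ℝ × (Fin d → ℝ)) →L[ℝ] (ℝ × (Fin d → ℝ))) (0, x₀) := by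
    have := hT.to_localInverse
    rwa [hT0] at this
  have hP0 : P (0, x₀) = (0, x₀) := by
    have := hT.localInverse_apply_image
    rwa [hT0] at this
  have hPr : ∀ᶠ p in 𝓝 ((0 : ℝ), x₀), T (P p) = p := by
    have := hT.eventually_right_inverse
    rwa [hT0] at this
  have hPl : ∀ᶠ p in 𝓝 ((0 : ℝ), x₀), P (T p) = p := hT.eventually_left_inverse
  have hPt : Tendsto P (𝓝 (0, x₀)) (𝓝 (0, x₀)) := by
    have := hPd.continuousAt.tendsto
    rwa [hP0] at this
  have hΦt : Tendsto (fun p : ℝ × (Fin d → ℝ) => (p.1, Φ p.1 p.2)) (𝓝 (0, x₀)) (𝓝 (0, x₀)) := by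
    have h1 : Tendsto (fun p : ℝ × (Fin d → ℝ) => Φ p.1 p.2) (𝓝 (0, x₀)) (𝓝 x₀) := by
      have := hΦ.continuousAt.tendsto
      rwa [Function.uncurry_apply_pair, hx₀] at this
    exact (continuous_fst.tendsto ((0 : ℝ), x₀)).prodMk_nhds h1
  have hTt : Tendsto T (𝓝 (0, x₀)) (𝓝 (0, x₀)) := by
    have := hT.continuousAt.tendsto
    rwa [hT0] at this
  refine ⟨fun h y => (P (h, y)).2, ⟨?_, ?_, ?_⟩, ?_⟩
  · exact (continuous_snd.tendsto ((0 : ℝ), x₀)).comp hPt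
  · filter_upwards [hPr] with p hp
    obtain ⟨h1, h2⟩ : (P p).1 = p.1 ∧ Φ (-(P p).1) (P p).2 = p.2 := Prod.ext_iff.1 hp
    rwa [h1] at h2
  · filter_upwards [hPl] with p hp
    exact congrArg Prod.snd hp
  -- Both `χ_h(y)` and `Φ_h(y)` are second components of values of the Lipschitz map `P`, at `(h,
  -- y)` and at `T (h, Φ_h(y))`. These arguments differ exactly by the symmetry defect.
  · obtain ⟨K, s, hs, hLip⟩ := hPd.exists_lipschitzOnWith
    have hb : ∀ᶠ p in 𝓝 ((0 : ℝ), x₀),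
        ‖(P p).2 - Φ p.1 p.2‖ ≤ K * ‖Φ (-p.1) (Φ p.1 p.2) - p.2‖ := by
      filter_upwards [hΦt.eventually hPl, hs,
        (hTt.comp hΦt).eventually (eventually_mem_set.2 hs)] with p hp hps hpT
      have h1 : Φ p.1 p.2 = (P (T (p.1, Φ p.1 p.2))).2 := by rw [hp]
      have h2 := hLip.norm_sub_le hps hpT
      calc ‖(P p).2 - Φ p.1 p.2‖ = ‖(P p - P (T (p.1, Φ p.1 p.2))).2‖ := by
            rw [Prod.snd_sub, ← h1]
        _ ≤ _ := norm_snd_le _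
        _ ≤ _ := h2
        _ = K * ‖Φ (-p.1) (Φ p.1 p.2) - p.2‖ := by
            have : p - T (p.1, Φ p.1 p.2) = (0, -(Φ (-p.1) (Φ p.1 p.2) - p.2)) := by
              refine Prod.ext (sub_self _) ?_
              simp [T]
            simp [this, Prod.norm_def, norm_sub_rev p.2]
    exact (IsBigO.of_bound (K : ℝ) hb).trans hsymm

end Adjoint

/-! ### Almost time symmetry of the real part. -/

section NearRealPoints

variable {d : ℕ}

theorem reL_I_smul (w : Fin d → ℂ) : reL (Complex.I • w) = -imL w := by
  ext i; simp

/-- A complex-analytic one-step map, read off at real points through a real-linear map. -/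
theorem analyticAt_comp_realPoint {Ψ : ℂ → (Fin d → ℂ) → (Fin d → ℂ)} {p : ℝ × (Fin d → ℝ)}
    (hΨ : AnalyticAt ℂ (Function.uncurry Ψ) (realPoint p))
    (ℓ : (Fin d → ℂ) →L[ℝ] (Fin d → ℝ)) :
    AnalyticAt ℝ (fun q => ℓ (Function.uncurry Ψ (realPoint q))) p :=
  (ℓ.analyticAt _).comp (hΨ.restrictScalars.comp (realPoint.analyticAt p))

theorem fderiv_comp_realPoint {Ψ : ℂ → (Fin d → ℂ) → (Fin d → ℂ)} {p : ℝ × (Fin d → ℝ)}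
    (hΨ : AnalyticAt ℂ (Function.uncurry Ψ) (realPoint p))
    (ℓ : (Fin d → ℂ) →L[ℝ] (Fin d → ℝ)) (v : ℝ × (Fin d → ℝ)) :
    fderiv ℝ (fun q => ℓ (Function.uncurry Ψ (realPoint q))) p v =
      ℓ (fderiv ℂ (Function.uncurry Ψ) (realPoint p) (realPoint v)) := by
  have h1 := (hΨ.differentiableAt.hasFDerivAt.restrictScalars ℝ).comp p realPoint.hasFDerivAt
  have h2 := ℓ.hasFDerivAt.comp p h1
  exact congrArg (fun l => l v) h2.fderiv

/-- If the imaginary part of a time-symmetric map is `O(h^N)` at real points, then its real part is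
time-symmetric up to `O(h^(2N))`. -/
theorem realPart_almost_symmetric {Ψ : ℂ → (Fin d → ℂ) → (Fin d → ℂ)} {x : Fin d → ℝ} {N : ℕ}
    (hΨ : AnalyticAt ℂ (Function.uncurry Ψ) (0, toComplex x))
    (hfix : Ψ 0 (toComplex x) = toComplex x)
    (hsymm : ∀ᶠ z in 𝓝 ((0 : ℂ), toComplex x), Ψ z.1 (Ψ (-z.1) z.2) = z.2)
    (him : (fun p : ℝ × (Fin d → ℝ) => imL (Ψ p.1 (toComplex p.2)))
      =O[𝓝 ((0 : ℝ), x)] fun p => p.1 ^ N) :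
    (fun p : ℝ × (Fin d → ℝ) =>
        reL (Ψ ((-p.1 : ℝ) : ℂ) (toComplex (reL (Ψ p.1 (toComplex p.2))))) - p.2)
      =O[𝓝 ((0 : ℝ), x)] fun p => p.1 ^ (2 * N) := by
  have hx0 : realPoint ((0 : ℝ), x) = (0, toComplex x) := by simp
  have hΨ' : AnalyticAt ℂ (Function.uncurry Ψ) (realPoint ((0 : ℝ), x)) := by rwa [hx0]
  set G : ℝ × (Fin d → ℝ) → (Fin d → ℝ) :=
    fun q => imL (Function.uncurry Ψ (realPoint q)) with hG
  have hGan : AnalyticAt ℝ G (0, x) := analyticAt_comp_realPoint hΨ' imL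
  have hGO : G =O[𝓝 ((0 : ℝ), x)] fun p => p.1 ^ N := him
  have hDG := fderiv_partial_isBigO hGan hGO
  have hrp : Tendsto (fun p : ℝ × (Fin d → ℝ) => realPoint p) (𝓝 (0, x)) (𝓝 (0, toComplex x)) :=
    realPoint.continuous.tendsto' _ _ hx0
  have hΨt : Tendsto (fun p : ℝ × (Fin d → ℝ) => Ψ p.1 (toComplex p.2)) (𝓝 (0, x))
      (𝓝 (toComplex x)) := by
    have := hΨ.continuousAt.tendsto.comp hrp
    rwa [Function.uncurry_apply_pair, hfix] at this
  have hat : Tendsto (fun p : ℝ × (Fin d → ℝ) => reL (Ψ p.1 (toComplex p.2))) (𝓝 (0, x))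
      (𝓝 x) :=
    (reL.continuous.tendsto' _ _ (reL_toComplex x)).comp hΨt
  have hnt : Tendsto (fun p : ℝ × (Fin d → ℝ) => -p.1) (𝓝 (0, x)) (𝓝 0) :=
    continuous_fst.neg.tendsto' _ _ (by simp)
  have hqt : Tendsto (fun p : ℝ × (Fin d → ℝ) => (-p.1, reL (Ψ p.1 (toComplex p.2))))
      (𝓝 (0, x)) (𝓝 (0, x)) := hnt.prodMk_nhds hat
  have hDGq : (fun p : ℝ × (Fin d → ℝ) =>
      (fderiv ℝ G (-p.1, reL (Ψ p.1 (toComplex p.2)))).comp (ContinuousLinearMap.inr ℝ ℝ _))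
      =O[𝓝 ((0 : ℝ), x)] fun p => p.1 ^ N := by
    refine (hDG.comp_tendsto hqt).trans (IsBigO.of_bound 1 (Eventually.of_forall fun p => ?_))
    simp
  obtain ⟨C, hC⟩ := taylor_two_bound hΨ
  have hnc : Tendsto (fun p : ℝ × (Fin d → ℝ) => ((-p.1 : ℝ) : ℂ)) (𝓝 (0, x)) (𝓝 0) :=
    (Complex.continuous_ofReal.tendsto' 0 0 (by simp)).comp hnt
  have hT : ∀ᶠ p : ℝ × (Fin d → ℝ) in 𝓝 ((0 : ℝ), x), _ :=
    ((hnc.prodMk_nhds hΨt).prodMk_nhds (hrp.comp hqt)).eventually hC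
  have hS : ∀ᶠ p : ℝ × (Fin d → ℝ) in 𝓝 ((0 : ℝ), x), _ :=
    (hnc.prodMk_nhds ((continuous_snd.tendsto _).comp hrp)).eventually hsymm
  have hA : ∀ᶠ p : ℝ × (Fin d → ℝ) in 𝓝 ((0 : ℝ), x), _ :=
    (hrp.comp hqt).eventually hΨ.eventually_analyticAt
  have hbound : ∀ᶠ p : ℝ × (Fin d → ℝ) in 𝓝 ((0 : ℝ), x),
      ‖reL (Ψ ((-p.1 : ℝ) : ℂ) (toComplex (reL (Ψ p.1 (toComplex p.2))))) - p.2‖ ≤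
        ‖C * ‖G p‖ ^ 2 + ‖(fderiv ℝ G (-p.1, reL (Ψ p.1 (toComplex p.2)))).comp
          (ContinuousLinearMap.inr ℝ ℝ _)‖ * ‖G p‖‖ := by
    filter_upwards [hT, hS, hA] with p hTp hSp hAp
    set a := reL (Ψ p.1 (toComplex p.2)) with ha
    have hb : G p = imL (Ψ p.1 (toComplex p.2)) := rfl
    have hsplit : Ψ p.1 (toComplex p.2) - toComplex a = Complex.I • toComplex (G p) := by
      rw [sub_eq_iff_eq_add', hb, toComplex_reL_add]
    have hSp' : Ψ ((-p.1 : ℝ) : ℂ) (Ψ p.1 (toComplex p.2)) = toComplex p.2 := by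
      simpa using hSp
    simp only [Function.comp_apply, realPoint_apply, Function.uncurry_apply_pair, Prod.mk_sub_mk,
      sub_self, hSp'] at hTp
    rw [← ha, hsplit] at hTp
    set v := toComplex p.2 - Ψ ((-p.1 : ℝ) : ℂ) (toComplex a) -
      fderiv ℂ (Function.uncurry Ψ) (((-p.1 : ℝ) : ℂ), toComplex a)
        (0, Complex.I • toComplex (G p)) with hv
    have hn : ‖((0 : ℂ), Complex.I • toComplex (G p))‖ = ‖G p‖ := by
      simp [Prod.norm_def, norm_smul, norm_toComplex]
    rw [hn] at hTp
    -- The decisive cancellation: by complex linearity `Re (Ψ' (i b)) = -Im (Ψ' b)`, and `Im Ψ'` on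
    -- real vectors is the derivative of `G`, already `O(h^N)`.
    have hlin : reL (fderiv ℂ (Function.uncurry Ψ) (((-p.1 : ℝ) : ℂ), toComplex a)
        (0, Complex.I • toComplex (G p))) = -(fderiv ℝ G (-p.1, a)).comp
          (ContinuousLinearMap.inr ℝ ℝ _) (G p) := by
      have e : ((0 : ℂ), Complex.I • toComplex (G p)) = Complex.I • realPoint (0, G p) := by
        ext <;> simp
      rw [e, map_smul, reL_I_smul]
      congr 1
      exact (fderiv_comp_realPoint hAp imL (0, G p)).symm
    have hre : reL v = p.2 - reL (Ψ ((-p.1 : ℝ) : ℂ) (toComplex a)) +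
        (fderiv ℝ G (-p.1, a)).comp (ContinuousLinearMap.inr ℝ ℝ _) (G p) := by
      rw [hv, map_sub, map_sub, hlin, reL_toComplex, sub_neg_eq_add]
    have e2 : reL (Ψ ((-p.1 : ℝ) : ℂ) (toComplex a)) - p.2 =
        (fderiv ℝ G (-p.1, a)).comp (ContinuousLinearMap.inr ℝ ℝ _) (G p) - reL v := by
      rw [hre]; abel
    rw [e2]
    refine le_trans ?_ (le_abs_self _)
    refine (norm_sub_le _ _).trans ?_
    rw [add_comm]
    exact add_le_add ((norm_reL_le _).trans hTp) (ContinuousLinearMap.le_opNorm _ _)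
  refine (IsBigO.of_norm_eventuallyLE hbound).trans ?_
  have e3 : (fun p : ℝ × (Fin d → ℝ) => p.1 ^ (2 * N)) = fun p => p.1 ^ N * p.1 ^ N := by
    funext p; ring
  rw [e3]
  refine (IsBigO.add ?_ (hDGq.norm_left.mul hGO.norm_left)).norm_left
  simpa only [sq] using (hGO.norm_left.mul hGO.norm_left).const_mul_left C

end NearRealPoints

/-! ### Analyticity and adjoints of compositions. -/

section Composition

variable {d : ℕ} {S : ℂ → (Fin d → ℂ) → (Fin d → ℂ)}

theorem composition_append_singleton (S : ℂ → (Fin d → ℂ) → (Fin d → ℂ)) (l : List ℂ) (a h : ℂ)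
    (w : Fin d → ℂ) : composition S (l ++ [a]) h w = S (a * h) (composition S l h w) := by
  induction l generalizing w with
  | nil => rfl
  | cons b l ih => exact ih _

theorem composition_zero {w₀ : Fin d → ℂ} (h0 : S 0 w₀ = w₀) (l : List ℂ) :
    composition S l 0 w₀ = w₀ := by
  induction l with
  | nil => rfl
  | cons a l ih =>
    change composition S l 0 (S (a * 0) w₀) = w₀
    rw [mul_zero, h0, ih]

theorem analyticAt_scaled {w₀ : Fin d → ℂ} (hS : AnalyticAt ℂ (Function.uncurry S) (0, w₀))
    (a : ℂ) : AnalyticAt ℂ (fun z : ℂ × (Fin d → ℂ) => S (a * z.1) z.2) (0, w₀) := by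
  refine hS.comp_of_eq (f := fun z : ℂ × (Fin d → ℂ) => (a * z.1, z.2)) ?_ (by simp)
  exact (analyticAt_const.mul analyticAt_fst).prod analyticAt_snd

theorem tendsto_scaled {w₀ : Fin d → ℂ} (hS : AnalyticAt ℂ (Function.uncurry S) (0, w₀))
    (h0 : S 0 w₀ = w₀) (a : ℂ) :
    Tendsto (fun z : ℂ × (Fin d → ℂ) => S (a * z.1) z.2) (𝓝 (0, w₀)) (𝓝 w₀) := by
  have := (analyticAt_scaled hS a).continuousAt.tendsto
  simpa [h0] using this

theorem analyticAt_composition {w₀ : Fin d → ℂ}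
    (hS : AnalyticAt ℂ (Function.uncurry S) (0, w₀)) (h0 : S 0 w₀ = w₀) (l : List ℂ) :
    AnalyticAt ℂ (Function.uncurry (composition S l)) (0, w₀) := by
  induction l with
  | nil => exact analyticAt_snd
  | cons a l ih =>
    refine ih.comp_of_eq (f := fun z : ℂ × (Fin d → ℂ) => (z.1, S (a * z.1) z.2)) ?_ (by simp [h0])
    exact analyticAt_fst.prod (analyticAt_scaled hS a)

/-- The composition with reversed coefficients is the adjoint of the composition. -/
theorem composition_reverse_comp {w₀ : Fin d → ℂ}
    (hS : AnalyticAt ℂ (Function.uncurry S) (0, w₀)) (h0 : S 0 w₀ = w₀)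
    (hsymm : ∀ᶠ z in 𝓝 ((0 : ℂ), w₀), S z.1 (S (-z.1) z.2) = z.2) (l : List ℂ) :
    ∀ᶠ z in 𝓝 ((0 : ℂ), w₀), composition S l.reverse z.1 (composition S l (-z.1) z.2) = z.2 := by
  induction l with
  | nil => exact Eventually.of_forall fun _ => rfl
  | cons a l ih =>
    -- The inner compositions cancel by induction at the moved point `S_{-ah}(w)`, leaving `S_{ah} ∘
    -- S_{-ah}`.
    have h1 : Tendsto (fun z : ℂ × (Fin d → ℂ) => (z.1, S (-a * z.1) z.2)) (𝓝 (0, w₀))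
        (𝓝 (0, w₀)) :=
      (continuous_fst.tendsto ((0 : ℂ), w₀)).prodMk_nhds (tendsto_scaled hS h0 (-a))
    have h2 : Tendsto (fun z : ℂ × (Fin d → ℂ) => (a * z.1, z.2)) (𝓝 (0, w₀)) (𝓝 (0, w₀)) := by
      have : Continuous (fun z : ℂ × (Fin d → ℂ) => (a * z.1, z.2)) := by fun_prop
      exact this.tendsto' _ _ (by simp)
    filter_upwards [h1.eventually ih, h2.eventually hsymm] with z hz1 hz2
    rw [List.reverse_cons, composition_append_singleton]
    have e : composition S (a :: l) (-z.1) z.2 = composition S l (-z.1) (S (-a * z.1) z.2) := by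
      change composition S l (-z.1) (S (a * -z.1) z.2) = _
      rw [neg_mul, mul_neg]
    rw [e, hz1, neg_mul]
    exact hz2

end Composition

/-! ### Complex Jacobians and preserved bilinear forms. -/

section ComplexJacobian

variable {d : ℕ}

/-- The complex Jacobian matrix of `g` at `w`. -/
noncomputable def complexJacobian (g : (Fin d → ℂ) → (Fin d → ℂ)) (w : Fin d → ℂ) :
    Matrix (Fin d) (Fin d) ℂ :=
  LinearMap.toMatrix' (fderiv ℂ g w : (Fin d → ℂ) →ₗ[ℂ] (Fin d → ℂ))

theorem complexJacobian_apply (g : (Fin d → ℂ) → (Fin d → ℂ)) (w : Fin d → ℂ) (i j : Fin d) :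
    complexJacobian g w i j = fderiv ℂ g w (Pi.single j 1) i := by
  simp [complexJacobian]

theorem jacobian_apply (g : (Fin d → ℝ) → (Fin d → ℝ)) (x : Fin d → ℝ) (i j : Fin d) :
    jacobian g x i j = fderiv ℝ g x (Pi.single j 1) i := by
  simp [jacobian]

theorem toComplex_single (j : Fin d) :
    toComplex (Pi.single j (1 : ℝ)) = Pi.single j (1 : ℂ) := by
  ext i
  by_cases h : i = j
  · subst h; simp [toComplex]
  · simp [toComplex, h]

theorem complexJacobian_comp {g k : (Fin d → ℂ) → (Fin d → ℂ)} {w : Fin d → ℂ}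
    (hg : DifferentiableAt ℂ g (k w)) (hk : DifferentiableAt ℂ k w) :
    complexJacobian (fun u => g (k u)) w = complexJacobian g (k w) * complexJacobian k w := by
  have : fderiv ℂ (fun u => g (k u)) w = (fderiv ℂ g (k w)).comp (fderiv ℂ k w) :=
    fderiv_comp w hg hk
  rw [complexJacobian, this, complexJacobian, complexJacobian, ← LinearMap.toMatrix'_comp]
  rfl

theorem fderiv_eq_fderiv_uncurry {F : ℂ → (Fin d → ℂ) → (Fin d → ℂ)} {z : ℂ × (Fin d → ℂ)}
    (hF : AnalyticAt ℂ (Function.uncurry F) z) (v : Fin d → ℂ) :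
    fderiv ℂ (F z.1) z.2 v = fderiv ℂ (Function.uncurry F) z (0, v) := by
  have h1 : HasFDerivAt (fun y : Fin d → ℂ => (z.1, y)) (ContinuousLinearMap.inr ℂ ℂ _) z.2 :=
    hasFDerivAt_prodMk_right z.1 z.2
  have h2 := (hF.differentiableAt.hasFDerivAt.comp z.2 h1).fderiv
  exact congrArg (fun l => l v) h2

theorem differentiableAt_of_uncurry {F : ℂ → (Fin d → ℂ) → (Fin d → ℂ)} {z : ℂ × (Fin d → ℂ)}
    (hF : AnalyticAt ℂ (Function.uncurry F) z) : DifferentiableAt ℂ (F z.1) z.2 :=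
  hF.differentiableAt.comp (f := fun y : Fin d → ℂ => (z.1, y)) z.2
    (hasFDerivAt_prodMk_right z.1 z.2).differentiableAt

theorem analyticAt_complexJacobian {F : ℂ → (Fin d → ℂ) → (Fin d → ℂ)} {z₀ : ℂ × (Fin d → ℂ)}
    (hF : AnalyticAt ℂ (Function.uncurry F) z₀) (i j : Fin d) :
    AnalyticAt ℂ (fun z : ℂ × (Fin d → ℂ) => complexJacobian (F z.1) z.2 i j) z₀ := by
  let ℓ : (ℂ × (Fin d → ℂ) →L[ℂ] (Fin d → ℂ)) →L[ℂ] ℂ :=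
    (ContinuousLinearMap.proj i).comp
      (ContinuousLinearMap.apply ℂ (Fin d → ℂ) ((0 : ℂ), Pi.single j (1 : ℂ)))
  have h1 : AnalyticAt ℂ (fun z => ℓ (fderiv ℂ (Function.uncurry F) z)) z₀ :=
    (ℓ.analyticAt _).comp hF.fderiv
  refine h1.congr ?_
  filter_upwards [hF.eventually_analyticAt] with z hz
  rw [complexJacobian_apply, fderiv_eq_fderiv_uncurry hz]
  rfl

/-- The Jacobian of a map read off at real points through a real-linear map. -/
theorem fderiv_comp_toComplex {g : (Fin d → ℂ) → (Fin d → ℂ)} {x : Fin d → ℝ}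
    (hg : DifferentiableAt ℂ g (toComplex x)) (ℓ : (Fin d → ℂ) →L[ℝ] (Fin d → ℝ))
    (v : Fin d → ℝ) :
    fderiv ℝ (fun y => ℓ (g (toComplex y))) x v = ℓ (fderiv ℂ g (toComplex x) (toComplex v)) := by
  have h1 := (hg.hasFDerivAt.restrictScalars ℝ).comp x toComplexL.hasFDerivAt
  exact congrArg (fun l => l v) (ℓ.hasFDerivAt.comp x h1).fderiv

theorem jacobian_reL {g : (Fin d → ℂ) → (Fin d → ℂ)} {x : Fin d → ℝ}
    (hg : DifferentiableAt ℂ g (toComplex x)) :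
    jacobian (fun y => reL (g (toComplex y))) x =
      (complexJacobian g (toComplex x)).map Complex.re := by
  ext i j
  rw [jacobian_apply, fderiv_comp_toComplex hg, Matrix.map_apply, complexJacobian_apply,
    toComplex_single]
  rfl

theorem jacobian_imL {g : (Fin d → ℂ) → (Fin d → ℂ)} {x : Fin d → ℝ}
    (hg : DifferentiableAt ℂ g (toComplex x)) :
    jacobian (fun y => imL (g (toComplex y))) x =
      (complexJacobian g (toComplex x)).map Complex.im := by
  ext i j
  rw [jacobian_apply, fderiv_comp_toComplex hg, Matrix.map_apply, complexJacobian_apply,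
    toComplex_single]
  rfl

/-- The Jacobian of a composition preserves every bilinear form that the Jacobian of the basic
map preserves. -/
theorem composition_preserves_form {S : ℂ → (Fin d → ℂ) → (Fin d → ℂ)} {w₀ : Fin d → ℂ}
    (hS : AnalyticAt ℂ (Function.uncurry S) (0, w₀)) (h0 : S 0 w₀ = w₀)
    (J : Matrix (Fin d) (Fin d) ℂ)
    (hJ : ∀ᶠ z in 𝓝 ((0 : ℂ), w₀),
      (complexJacobian (S z.1) z.2).transpose * J * complexJacobian (S z.1) z.2 = J)
    (l : List ℂ) :
    ∀ᶠ z in 𝓝 ((0 : ℂ), w₀), (complexJacobian (composition S l z.1) z.2).transpose * J *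
      complexJacobian (composition S l z.1) z.2 = J := by
  induction l with
  | nil =>
    refine Eventually.of_forall fun z => ?_
    have : complexJacobian (composition S [] z.1) z.2 = 1 := by
      have e : composition S [] z.1 = id := rfl
      rw [e, complexJacobian, fderiv_id]
      exact LinearMap.toMatrix'_id
    simp [this]
  | cons a l ih =>
    have h1 : Tendsto (fun z : ℂ × (Fin d → ℂ) => (z.1, S (a * z.1) z.2)) (𝓝 (0, w₀))
        (𝓝 (0, w₀)) :=
      (continuous_fst.tendsto ((0 : ℂ), w₀)).prodMk_nhds (tendsto_scaled hS h0 a)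
    have h2 : Tendsto (fun z : ℂ × (Fin d → ℂ) => (a * z.1, z.2)) (𝓝 (0, w₀)) (𝓝 (0, w₀)) := by
      have : Continuous (fun z : ℂ × (Fin d → ℂ) => (a * z.1, z.2)) := by fun_prop
      exact this.tendsto' _ _ (by simp)
    filter_upwards [h1.eventually ih, h2.eventually hJ, h2.eventually hS.eventually_analyticAt,
      h1.eventually (analyticAt_composition hS h0 l).eventually_analyticAt] with z hz1 hz2 hz3 hz4
    have e : complexJacobian (composition S (a :: l) z.1) z.2 =
        complexJacobian (composition S l z.1) (S (a * z.1) z.2) *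
          complexJacobian (S (a * z.1)) z.2 :=
      complexJacobian_comp (g := composition S l z.1) (differentiableAt_of_uncurry hz4)
        (differentiableAt_of_uncurry hz3)
    rw [e, Matrix.transpose_mul]
    set A := complexJacobian (composition S l z.1) (S (a * z.1) z.2)
    set B := complexJacobian (S (a * z.1)) z.2
    calc B.transpose * A.transpose * J * (A * B) = B.transpose * (A.transpose * J * A) * B := by
          simp only [Matrix.mul_assoc]
      _ = J := by rw [hz1]; exact hz2

/-- The real part of `Mᵀ J M = J` for real `J`. -/
theorem re_form_sub {M : Matrix (Fin d) (Fin d) ℂ} {J : Matrix (Fin d) (Fin d) ℝ}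
    (h : M.transpose * J.map (Complex.ofReal) * M = J.map Complex.ofReal) :
    (M.map Complex.re).transpose * J * M.map Complex.re - J =
      (M.map Complex.im).transpose * J * M.map Complex.im := by
  ext i j
  have hij := congrArg Complex.re (congrFun (congrFun h i) j)
  simp only [Matrix.mul_apply, Matrix.transpose_apply, Matrix.map_apply, Complex.re_sum,
    Complex.mul_re, Complex.im_sum, Complex.mul_im, Complex.ofReal_re, Complex.ofReal_im, mul_zero,
    sub_zero, zero_add, Finset.sum_sub_distrib] at hij
  simp only [Matrix.sub_apply, Matrix.mul_apply, Matrix.transpose_apply, Matrix.map_apply]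
  linarith

end ComplexJacobian

/-! ### Passage from real points to complex ones, and estimates for the real part. -/

section Main

variable {d : ℕ} {D : Set (Fin d → ℝ)}
  {φ R : ℝ → (Fin d → ℝ) → (Fin d → ℝ)} {S : ℂ → (Fin d → ℂ) → (Fin d → ℂ)}

/-- The neighbourhood in the big-O is not punctured, so the bound holds at `(0, x)` itself, where `0
^ (r + 1) = 0`. -/
theorem HasOrder.apply_zero {V : Type*} [NormedAddCommGroup V]
    {exact ψ : ℝ → (Fin d → ℝ) → V} {r : ℕ} (h : HasOrder D exact ψ r) {x : Fin d → ℝ}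
    (hx : x ∈ D) : ψ 0 x = exact 0 x := by
  obtain ⟨C, hC⟩ := (h x hx).bound
  have := hC.self_of_nhds
  simpa [sub_eq_zero] using this

theorem HasOrder.mono {V : Type*} [NormedAddCommGroup V]
    {exact ψ : ℝ → (Fin d → ℝ) → V} {r q : ℕ} (h : HasOrder D exact ψ r) (hq : q ≤ r) :
    HasOrder D exact ψ q := by
  intro x hx
  refine (h x hx).trans ?_
  have h1 : (fun t : ℝ => t ^ (r + 1)) =O[𝓝 0] fun t => t ^ (q + 1) :=
    isBigO_iff.2 ⟨1, by
      filter_upwards [Metric.ball_mem_nhds (0 : ℝ) one_pos] with t ht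
      have ht1 : ‖t‖ ≤ 1 := by simpa using (Metric.mem_ball.1 ht).le
      rw [norm_pow, norm_pow, one_mul]
      exact pow_le_pow_of_le_one (norm_nonneg t) ht1 (by omega)⟩
  exact h1.comp_tendsto (continuous_fst.tendsto ((0 : ℝ), x))

theorem IsComplexExtension.eventually_real (hS : IsComplexExtension D R S) {x : Fin d → ℝ}
    (hx : x ∈ D) : ∀ᶠ p : ℝ × (Fin d → ℝ) in 𝓝 (0, x),
      Function.uncurry S (realPoint p) = toComplex (R p.1 p.2) := hS.extends_real x hx

/-- The complex coefficients require the symmetry off the real points. The defect is holomorphic and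
vanishes at real points, hence identically near them. -/
theorem IsComplexExtension.symmetric (hS : IsComplexExtension D R S) {x : Fin d → ℝ}
    (hx : x ∈ D) (h0 : S 0 (toComplex x) = toComplex x) (hR : IsTimeSymmetric D R) :
    ∀ᶠ z in 𝓝 ((0 : ℂ), toComplex x), S z.1 (S (-z.1) z.2) = z.2 := by
  have hx0 : realPoint ((0 : ℝ), x) = (0, toComplex x) := by simp
  have han := hS.analytic x hx
  have hcomp : AnalyticAt ℂ (fun z : ℂ × (Fin d → ℂ) => S z.1 (S (-z.1) z.2) - z.2)
      (realPoint ((0 : ℝ), x)) := by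
    rw [hx0]
    refine AnalyticAt.sub ?_ analyticAt_snd
    refine han.comp_of_eq (f := fun z : ℂ × (Fin d → ℂ) => (z.1, S (-z.1) z.2)) ?_ (by simp [h0])
    have := analyticAt_scaled han (-1)
    simp only [neg_one_mul] at this
    exact analyticAt_fst.prod this
  have hR0 : R 0 x = x := by
    have := (hS.extends_real x hx).self_of_nhds
    simp only [Complex.ofReal_zero, h0] at this
    simpa using (congrArg reL this).symm
  have hRt : Tendsto (fun p : ℝ × (Fin d → ℝ) => R p.1 p.2) (𝓝 (0, x)) (𝓝 x) := by
    have h1 : Tendsto (fun p => reL (Function.uncurry S (realPoint p))) (𝓝 ((0 : ℝ), x)) (𝓝 x) := by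
      have := (analyticAt_comp_realPoint (hx0 ▸ han) reL).continuousAt.tendsto
      simpa [h0] using this
    refine h1.congr' ?_
    filter_upwards [hS.eventually_real hx] with p hp
    rw [hp, reL_toComplex]
  have hn : Tendsto (fun p : ℝ × (Fin d → ℝ) => (-p.1, p.2)) (𝓝 (0, x)) (𝓝 (0, x)) := by
    have : Continuous (fun p : ℝ × (Fin d → ℝ) => (-p.1, p.2)) := by fun_prop
    exact this.tendsto' _ _ (by simp)
  have hq : Tendsto (fun p : ℝ × (Fin d → ℝ) => (p.1, R (-p.1) p.2)) (𝓝 (0, x)) (𝓝 (0, x)) :=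
    (continuous_fst.tendsto ((0 : ℝ), x)).prodMk_nhds (hRt.comp hn)
  have hzero := eventually_eq_zero_of_real hcomp (by
    filter_upwards [hn.eventually (hS.extends_real x hx), hq.eventually (hS.extends_real x hx),
      hR x hx] with p h1 h2 h3
    simp only [Complex.ofReal_neg] at h1
    simp only [realPoint_apply]
    rw [h1, h2, h3, sub_self])
  rw [hx0] at hzero
  filter_upwards [hzero] with z hz
  exact sub_eq_zero.1 hz

/-- At real points the complex Jacobian has zero imaginary part and equals the real one. The
identity theorem, applied entrywise, does the rest. -/
theorem IsComplexExtension.symplectic (hS : IsComplexExtension D R S) {x : Fin d → ℝ}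
    (hx : x ∈ D) {m : ℕ} (e : Fin m ⊕ Fin m ≃ Fin d) (hR : IsSymplectic e D R) :
    ∀ᶠ z in 𝓝 ((0 : ℂ), toComplex x), (complexJacobian (S z.1) z.2).transpose *
      (canonicalJ e).map Complex.ofReal * complexJacobian (S z.1) z.2 =
        (canonicalJ e).map Complex.ofReal := by
  have hx0 : realPoint ((0 : ℝ), x) = (0, toComplex x) := by simp
  have han : AnalyticAt ℂ (Function.uncurry S) (realPoint ((0 : ℝ), x)) :=
    hx0.symm ▸ hS.analytic x hx
  set Jc : Matrix (Fin d) (Fin d) ℂ := (canonicalJ e).map Complex.ofReal with hJc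
  have hreal : ∀ᶠ p in 𝓝 ((0 : ℝ), x), (complexJacobian (S (realPoint p).1) (realPoint p).2).transpose
      * Jc * complexJacobian (S (realPoint p).1) (realPoint p).2 = Jc := by
    filter_upwards [(hS.extends_real x hx).eventually_nhds, hR x hx,
      (realPoint.continuous.tendsto ((0 : ℝ), x)).eventually han.eventually_analyticAt]
      with p h1 h2 h3
    -- Comparing Jacobians needs agreement on a neighbourhood in `y`, with the step fixed.
    have h4 : ∀ᶠ y in 𝓝 p.2, S (p.1 : ℂ) (toComplex y) = toComplex (R p.1 y) :=
      ((Continuous.prodMk_right p.1).tendsto p.2).eventually h1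
    have hd : DifferentiableAt ℂ (S (p.1 : ℂ)) (toComplex p.2) := differentiableAt_of_uncurry h3
    have hre : jacobian (R p.1) p.2 =
        (complexJacobian (S (p.1 : ℂ)) (toComplex p.2)).map Complex.re := by
      rw [← jacobian_reL hd, jacobian, jacobian]
      congr 2
      refine Filter.EventuallyEq.fderiv_eq ?_
      filter_upwards [h4] with y hy
      rw [hy, reL_toComplex]
    have him : (complexJacobian (S (p.1 : ℂ)) (toComplex p.2)).map Complex.im = 0 := by
      rw [← jacobian_imL hd, jacobian]
      have : (fun y => imL (S (p.1 : ℂ) (toComplex y))) =ᶠ[𝓝 p.2] fun _ => 0 := by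
        filter_upwards [h4] with y hy
        rw [hy, imL_toComplex]
      rw [this.fderiv_eq]
      simp
    have hmat : complexJacobian (S (p.1 : ℂ)) (toComplex p.2) =
        (jacobian (R p.1) p.2).map Complex.ofRealHom := by
      ext i j
      apply Complex.ext
      · simp [hre]
      · simpa using congrFun (congrFun him i) j
    have hJ' : Jc = (canonicalJ e).map Complex.ofRealHom := rfl
    simp only [realPoint_apply]
    rw [hmat, hJ', ← Matrix.transpose_map, ← Matrix.map_mul, ← Matrix.map_mul, h2]
  have hentry : ∀ i j, ∀ᶠ z in 𝓝 ((0 : ℂ), toComplex x),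
      ((complexJacobian (S z.1) z.2).transpose * Jc * complexJacobian (S z.1) z.2) i j
        - Jc i j = 0 := by
    intro i j
    rw [← hx0]
    refine eventually_eq_zero_of_real ?_ ?_
    · simp only [Matrix.mul_apply, Matrix.transpose_apply]
      refine AnalyticAt.sub ?_ analyticAt_const
      refine Finset.analyticAt_fun_sum _ fun k _ => AnalyticAt.mul ?_ (analyticAt_complexJacobian han _ _)
      exact Finset.analyticAt_fun_sum _ fun k' _ =>
        (analyticAt_complexJacobian han _ _).mul analyticAt_const
    · filter_upwards [hreal] with p hp
      rw [hp, sub_self]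
  filter_upwards [eventually_all.2 fun i => eventually_all.2 fun j => hentry i j] with z hz
  ext i j
  exact sub_eq_zero.1 (hz i j)

theorem hasOrder_realPart {ψ : ℝ → (Fin d → ℝ) → (Fin d → ℂ)} {r : ℕ}
    (h : HasOrder D (fun h x => toComplex (φ h x)) ψ r) : HasOrder D φ (realPart ψ) r := by
  intro x hx
  refine IsBigO.trans (IsBigO.of_bound 1 (Eventually.of_forall fun p => ?_)) (h x hx)
  have : realPart ψ p.1 p.2 - φ p.1 p.2 = reL (ψ p.1 p.2 - toComplex (φ p.1 p.2)) := by
    rw [map_sub, reL_toComplex]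
    rfl
  rw [this, one_mul]
  exact norm_reL_le _

/-- The exact flow is real, so the imaginary part sees only the error. -/
theorem imL_isBigO_of_hasOrder {ψ : ℝ → (Fin d → ℝ) → (Fin d → ℂ)} {r : ℕ}
    (h : HasOrder D (fun h x => toComplex (φ h x)) ψ r) {x : Fin d → ℝ} (hx : x ∈ D) :
    (fun p : ℝ × (Fin d → ℝ) => imL (ψ p.1 p.2)) =O[𝓝 ((0 : ℝ), x)] fun p => p.1 ^ (r + 1) := by
  refine IsBigO.trans (IsBigO.of_bound 1 (Eventually.of_forall fun p => ?_)) (h x hx)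
  have : imL (ψ p.1 p.2) = imL (ψ p.1 p.2 - toComplex (φ p.1 p.2)) := by
    rw [map_sub, imL_toComplex, sub_zero]
  rw [this, one_mul]
  exact norm_imL_le _

/-- If the imaginary part of `Ψ` is `O(h^N)` at real points and the complex Jacobian of `Ψ`
preserves `J`, then the Jacobian of the real part preserves `J` up to `O(h^(2N))`. -/
theorem realPart_almost_preserves_form {Ψ : ℂ → (Fin d → ℂ) → (Fin d → ℂ)} {x : Fin d → ℝ} {N : ℕ}
    (hΨ : AnalyticAt ℂ (Function.uncurry Ψ) (0, toComplex x)) (J : Matrix (Fin d) (Fin d) ℝ)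
    (hJ : ∀ᶠ z in 𝓝 ((0 : ℂ), toComplex x), (complexJacobian (Ψ z.1) z.2).transpose *
      J.map Complex.ofReal * complexJacobian (Ψ z.1) z.2 = J.map Complex.ofReal)
    (him : (fun p : ℝ × (Fin d → ℝ) => imL (Ψ p.1 (toComplex p.2)))
      =O[𝓝 ((0 : ℝ), x)] fun p => p.1 ^ N) (i j : Fin d) :
    (fun p : ℝ × (Fin d → ℝ) =>
      ((jacobian (fun y => reL (Ψ p.1 (toComplex y))) p.2).transpose * J *
        jacobian (fun y => reL (Ψ p.1 (toComplex y))) p.2 - J) i j)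
      =O[𝓝 ((0 : ℝ), x)] fun p => p.1 ^ (2 * N) := by
  have hx0 : realPoint ((0 : ℝ), x) = (0, toComplex x) := by simp
  have hΨ' : AnalyticAt ℂ (Function.uncurry Ψ) (realPoint ((0 : ℝ), x)) := by rwa [hx0]
  have hrp : Tendsto (fun p : ℝ × (Fin d → ℝ) => realPoint p) (𝓝 (0, x)) (𝓝 (0, toComplex x)) :=
    realPoint.continuous.tendsto' _ _ hx0
  set G : ℝ × (Fin d → ℝ) → (Fin d → ℝ) :=
    fun q => imL (Function.uncurry Ψ (realPoint q)) with hG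
  have hDG := fderiv_partial_isBigO (analyticAt_comp_realPoint hΨ' imL) him
  set B : ℝ × (Fin d → ℝ) → Matrix (Fin d) (Fin d) ℝ :=
    fun p => (complexJacobian (Ψ p.1) (toComplex p.2)).map Complex.im with hB
  have hBO : ∀ k l, (fun p => B p k l) =O[𝓝 ((0 : ℝ), x)] fun p => p.1 ^ N := by
    intro k l
    refine IsBigO.trans (IsBigO.of_bound 1 ?_) hDG
    filter_upwards [hrp.eventually hΨ.eventually_analyticAt] with p hp
    -- The imaginary part of the complex Jacobian is the Jacobian of the imaginary part, so `hDG`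
    -- controls it.
    have e : B p k l = (fderiv ℝ G p).comp (ContinuousLinearMap.inr ℝ ℝ _) (Pi.single l 1) k := by
      have h1 : (fderiv ℝ G p).comp (ContinuousLinearMap.inr ℝ ℝ _) (Pi.single l 1) = _ :=
        fderiv_comp_realPoint hp imL (0, Pi.single l 1)
      rw [h1]
      have h2 := fderiv_eq_fderiv_uncurry hp (Pi.single l 1)
      simp only [realPoint_apply] at h2
      simp only [hB, Matrix.map_apply, complexJacobian_apply, imL_apply, realPoint_apply,
        toComplex_single, Complex.ofReal_zero, h2]
    rw [e, one_mul]
    refine (norm_le_pi_norm _ k).trans ((ContinuousLinearMap.le_opNorm _ _).trans_eq ?_)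
    rw [Pi.norm_single, norm_one, mul_one]
  have hcongr : (fun p : ℝ × (Fin d → ℝ) => ((B p).transpose * J * B p) i j) =ᶠ[𝓝 ((0 : ℝ), x)]
      fun p => ((jacobian (fun y => reL (Ψ p.1 (toComplex y))) p.2).transpose * J *
        jacobian (fun y => reL (Ψ p.1 (toComplex y))) p.2 - J) i j := by
    filter_upwards [hrp.eventually hΨ.eventually_analyticAt, hrp.eventually hJ] with p hp hpJ
    have hd : DifferentiableAt ℂ (Ψ p.1) (toComplex p.2) := differentiableAt_of_uncurry hp
    rw [jacobian_reL hd]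
    exact (congrFun (congrFun (re_form_sub hpJ) i) j).symm
  refine IsBigO.congr' ?_ hcongr EventuallyEq.rfl
  simp only [Matrix.mul_apply, Matrix.transpose_apply]
  refine IsBigO.fun_sum fun k _ => ?_
  have e3 : (fun p : ℝ × (Fin d → ℝ) => p.1 ^ (2 * N)) = fun p => p.1 ^ N * p.1 ^ N := by
    funext p; ring
  rw [e3]
  refine IsBigO.mul (IsBigO.fun_sum fun l _ => ?_) (hBO k j)
  simpa only [mul_comm] using (hBO l i).const_mul_left (J l k)

end Main

end PalindromicComposition

theorem proposition1 {d : ℕ}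
    -- a real vector field on an open set, and its exact flow
    (D : Set (Fin d → ℝ)) (hD : IsOpen D)
    (f : (Fin d → ℝ) → (Fin d → ℝ)) (hf : AnalyticOnNhd ℝ f D)
    (φ : ℝ → (Fin d → ℝ) → (Fin d → ℝ)) (hφ : PalindromicComposition.IsExactFlow f D φ)
    -- the basic method, time-symmetric of order 2, and its extension to complex steps
    (R : ℝ → (Fin d → ℝ) → (Fin d → ℝ)) (S : ℂ → (Fin d → ℂ) → (Fin d → ℂ))
    (hS : PalindromicComposition.IsComplexExtension D R S)
    (hR_order : PalindromicComposition.HasOrder D φ R 2)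
    (hR_symm : PalindromicComposition.IsTimeSymmetric D R)
    -- a palindromic composition with complex coefficients, of order 2n
    (n : ℕ) (hn : 2 ≤ n) (α : List ℂ) (hα_pal : α.reverse = α) (hα_sum : α.sum = 1)
    (hα_order : PalindromicComposition.HasOrder D
      (fun h x => PalindromicComposition.toComplex (φ h x))
      (PalindromicComposition.compositionOnReal S α) (2 * n)) :
    PalindromicComposition.HasOrder D φ
        (PalindromicComposition.realPart (PalindromicComposition.compositionOnReal S α)) (2 * n) ∧
      PalindromicComposition.IsPseudoSymmetric D φ
        (PalindromicComposition.realPart (PalindromicComposition.compositionOnReal S α))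
        (4 * n + 1) ∧
      ∀ (m : ℕ) (e : Fin m ⊕ Fin m ≃ Fin d), PalindromicComposition.IsHamiltonian e D f →
        PalindromicComposition.IsSymplectic e D R →
        PalindromicComposition.IsPseudoSymplectic e D φ
          (PalindromicComposition.realPart (PalindromicComposition.compositionOnReal S α))
          (4 * n + 1) := by
  open PalindromicComposition in
  have h0 : ∀ x ∈ D, S 0 (toComplex x) = toComplex x := by
    intro x hx
    have h1 := (hS.extends_real x hx).self_of_nhds
    rwa [hR_order.apply_zero hx, hφ.initial x hx, Complex.ofReal_zero] at h1
  have han : ∀ x ∈ D, AnalyticAt ℂ (Function.uncurry (composition S α)) (0, toComplex x) :=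
    fun x hx => analyticAt_composition (hS.analytic x hx) (h0 x hx) α
  have hΦan : ∀ x ∈ D, AnalyticAt ℝ (Function.uncurry (realPart (compositionOnReal S α)))
      (0, x) := fun x hx => analyticAt_comp_realPoint (by simpa using han x hx) reL
  have horder := hasOrder_realPart hα_order
  have him := fun x (hx : x ∈ D) => imL_isBigO_of_hasOrder hα_order hx
  -- The imaginary part is `O(h^(2n+1))`, and both defects are quadratic in it.
  have hexp : 4 * n + 1 + 1 = 2 * (2 * n + 1) := by ring
  have hint : IsIntegrator D φ (realPart (compositionOnReal S α)) := by
    refine ⟨fun x hx => ?_, horder.mono (by omega)⟩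
    filter_upwards [(hΦan x hx).eventually_analyticAt] with p hp
    exact hp.contDiffAt
  refine ⟨horder, ⟨hint, fun x hx => ?_⟩, fun m e _ hsymp => ⟨hint, fun x hx i j => ?_⟩⟩
  · rw [hexp]
    refine exists_adjoint (hΦan x hx) ?_ ?_
    · filter_upwards [hD.mem_nhds hx] with y hy
      rw [horder.apply_zero hy, hφ.initial y hy]
    · have hsymm := composition_reverse_comp (hS.analytic x hx) (h0 x hx)
        (hS.symmetric hx (h0 x hx) hR_symm) α
      -- The palindrome makes the composition its own adjoint.
      rw [hα_pal] at hsymm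
      exact realPart_almost_symmetric (han x hx) (composition_zero (h0 x hx) α) hsymm (him x hx)
  · rw [hexp]
    exact realPart_almost_preserves_form (han x hx) (canonicalJ e)
      (composition_preserves_form (hS.analytic x hx) (h0 x hx) _ (hS.symplectic hx e hsymp) α)
      (him x hx) i j
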